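/- Let $q$ be a prime power, let $n\ge 2$, let $K=\mathbb{F}_{q^n}$, and let $\sigma$ be an automorphism of $K$ with fixed field $\mathbb{F}_q$. Let $R=K[t;\sigma]$ be the skew polynomial ring: the polynomials in $t$ with coefficients in $K$ (written on the left), with termwise addition and with multiplication determined by $ta=a^{\sigma}t$ for $a\in K$. Let $f\in R$ have degree $d\ge 2$ and be irreducible, i.e. there are no $a,b\in R$ with $\deg a,\deg b<\deg f$ and $f=ab$. Let $\mathbb{S}_f$ be the semifield formed by the elements of $R$ of degree less than $d$, with the addition of $R$ and with the multiplication $a\circ_f b := ab \bmod_r f$, the remainder of $ab$ on right division by $f$ (the unique $r$ with $\deg r<d$ and $ab-r\in Rf$). Let $$\mathbb{N}_l,\quad \mathbb{N}_m,\quad \mathbb{N}_r$$ be the left, middle and right nucleus of $\mathbb{S}_f$, i.e. the sets of those $x$, respectively $y$, respectively $z$ in $\mathbb{S}_f$ for which $x\circ_f(y\circ_f z)=(x\circ_f y)\circ_f z$ holds for all values in $\mathbb{S}_f$ of the other two variables, and let the centre $Z$ be the set of the elements of $\mathbb{N}_l\cap\mathbb{N}_m\cap\mathbb{N}_r$ that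 commute with all elements of $\mathbb{S}_f$. Then $$(\#Z,\ \#\mathbb{N}_l,\ \#\mathbb{N}_m,\ \#\mathbb{N}_r)=(q,\ q^n,\ q^n,\ q^d).$$ -/

import Mathlib

noncomputable section

namespace SkewSemifield

universe u

variable {K : Type u} [Field K]

/-- A copy of the field `K`, on which the indeterminate of the skew polynomial ring acts by `σ`. -/
def Twist (_σ : K ≃+* K) : Type u := K

instance (σ : K ≃+* K) : Field (Twist σ) := inferInstanceAs (Field K)

/-- The action of the powers of the indeterminate on the coefficients: `t ^ k` acts as the `k`-th
iterate of `σ`. -/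
instance (σ : K ≃+* K) : MulSemiringAction (Multiplicative ℕ) (Twist σ) where
  smul k a := (σ ^ (Multiplicative.toAdd k) : K ≃+* K) (a : K)
  one_smul _ := rfl
  mul_smul k l a := by
    change (σ ^ (Multiplicative.toAdd k + Multiplicative.toAdd l) : K ≃+* K) (a : K) = _
    rw [pow_add]; rfl
  smul_zero k := map_zero (σ ^ (Multiplicative.toAdd k) : K ≃+* K)
  smul_add k := map_add (σ ^ (Multiplicative.toAdd k) : K ≃+* K)
  smul_one k := map_one (σ ^ (Multiplicative.toAdd k) : K ≃+* K)
  smul_mul k := map_mul (σ ^ (Multiplicative.toAdd k) : K ≃+* K)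

/-- The skew polynomial ring `K[t;σ]`: polynomials with coefficients (on the left) in `K`,
termwise addition, and multiplication determined by `t * a = σ a * t` for `a` in `K`. -/
abbrev SkewPoly (σ : K ≃+* K) : Type u := SkewPolynomial (Twist σ)

variable {σ : K ≃+* K}

/-- The coefficient map of `K[t;σ]` is `σ`. -/
theorem phi_eq (a : Twist σ) : SkewPolynomial.φ a = (show Twist σ from σ (show K from a)) := rfl

/-- The defining relation `t * a = σ a * t` of `K[t;σ]`. -/
theorem X_mul_C (a : Twist σ) :
    (SkewPolynomial.X * SkewPolynomial.C a : SkewPoly σ) =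
      SkewPolynomial.C (show Twist σ from σ (show K from a)) * SkewPolynomial.X := by
  rw [← phi_eq, SkewPolynomial.C_mul_X_eq_monomial, ← SkewPolynomial.monomial_one_one_eq_X,
    SkewPolynomial.monomial_mul_C, one_mul, Function.iterate_one]

/-- The degree of a skew polynomial (with the value `0` at the zero polynomial). -/
def natDegree (p : SkewPoly σ) : ℕ := p.support.sup id

/-- `f` is irreducible: it is not a product of two skew polynomials of degree less than
`deg f`. -/
def IsIrred (f : SkewPoly σ) : Prop :=
  ¬ ∃ a b : SkewPoly σ, natDegree a < natDegree f ∧ natDegree b < natDegree f ∧ f = a * b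

/-- The left `K`-vector space of the skew polynomials of degree less than `d`. -/
def degreeLT (σ : K ≃+* K) (d : ℕ) : Submodule (Twist σ) (SkewPoly σ) where
  carrier := {a | ∀ i, d ≤ i → a.coeff i = 0}
  add_mem' ha hb i hi := by rw [SkewPolynomial.coeff_add, ha i hi, hb i hi, add_zero]
  zero_mem' i _ := SkewPolynomial.coeff_zero i
  smul_mem' c a ha i hi := by
    change c • a.coeff i = 0
    rw [ha i hi, smul_zero]

theorem mem_degreeLT {d : ℕ} {a : SkewPoly σ} :
    a ∈ degreeLT σ d ↔ ∀ i, d ≤ i → a.coeff i = 0 := Iff.rfl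

theorem degreeLT_mono {d e : ℕ} (h : d ≤ e) {a : SkewPoly σ} (ha : a ∈ degreeLT σ d) :
    a ∈ degreeLT σ e := fun i hi => ha i (h.trans hi)

theorem mem_degreeLT_iff_natDegree_lt {d : ℕ} {a : SkewPoly σ} (ha : a ≠ 0) :
    a ∈ degreeLT σ d ↔ natDegree a < d := by
  have hs : a.support.Nonempty := by
    rw [Finset.nonempty_iff_ne_empty]
    exact fun h => ha (SkewPolynomial.support_eq_empty.mp h)
  have hd : natDegree a ∈ a.support := by
    obtain ⟨i, hi, h⟩ := Finset.exists_mem_eq_sup a.support hs id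
    rw [natDegree, h]; exact hi
  constructor
  · intro h
    by_contra! hlt
    exact SkewPolynomial.mem_support_iff.mp hd (h _ hlt)
  · intro h i hi
    by_contra hne
    have : i ≤ natDegree a := Finset.le_sup (f := id) (SkewPolynomial.mem_support_iff.mpr hne)
    omega

theorem mem_degreeLT_natDegree_succ (a : SkewPoly σ) : a ∈ degreeLT σ (natDegree a + 1) := by
  by_cases ha : a = 0
  · rw [ha]; exact zero_mem _
  · exact (mem_degreeLT_iff_natDegree_lt ha).mpr (Nat.lt_succ_self _)

theorem coeff_natDegree_ne_zero {a : SkewPoly σ} (ha : a ≠ 0) : a.coeff (natDegree a) ≠ 0 := by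
  intro h
  have : a ∈ degreeLT σ (natDegree a) := by
    intro i hi
    rcases hi.eq_or_lt with rfl | hi
    · exact h
    · exact mem_degreeLT_natDegree_succ a i hi
  exact lt_irrefl _ ((mem_degreeLT_iff_natDegree_lt ha).mp this)

theorem iterate_phi_eq_zero {k : ℕ} {a : Twist σ} :
    (SkewPolynomial.φ : Twist σ →+* Twist σ)^[k] a = 0 ↔ a = 0 := by
  rw [← RingHom.coe_pow]
  exact map_eq_zero _

theorem coeff_monomial_mul (k : ℕ) (c : Twist σ) (g : SkewPoly σ) (i : ℕ) :
    (SkewPolynomial.monomial k c * g : SkewPoly σ).coeff (k + i) =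
      c * SkewPolynomial.φ^[k] (g.coeff i) := by
  induction g using SkewPolynomial.induction with
  | h0 => simp
  | ha m r q _ _ ih =>
    rw [mul_add, SkewPolynomial.coeff_add, ih, SkewPolynomial.coeff_add,
      SkewPolynomial.monomial_mul_monomial, SkewPolynomial.coeff_monomial,
      SkewPolynomial.coeff_monomial, ← RingHom.coe_pow, map_add, mul_add]
    by_cases h : m = i
    · simp [h]
    · simp [h]

theorem monomial_mul_mem {k e : ℕ} (c : Twist σ) {g : SkewPoly σ} (hg : g ∈ degreeLT σ e) :
    (SkewPolynomial.monomial k c * g : SkewPoly σ) ∈ degreeLT σ (k + e) := by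
  intro i hi
  obtain ⟨j, rfl⟩ : ∃ j, i = k + j := ⟨i - k, by omega⟩
  rw [coeff_monomial_mul, hg j (by omega), iterate_phi_eq_zero.mpr rfl, mul_zero]

theorem sub_monomial_mem {m : ℕ} {a : SkewPoly σ} (ha : a ∈ degreeLT σ (m + 1)) :
    a - SkewPolynomial.monomial m (a.coeff m) ∈ degreeLT σ m := by
  intro i hi
  rw [SkewPolynomial.coeff_sub, SkewPolynomial.coeff_monomial]
  rcases hi.eq_or_lt with rfl | hi
  · simp
  · rw [ha i hi, if_neg hi.ne, sub_zero]

theorem mul_mem_degreeLT {m d : ℕ} {a g : SkewPoly σ} (ha : a ∈ degreeLT σ m)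
    (hg : g ∈ degreeLT σ (d + 1)) : a * g ∈ degreeLT σ (m + d) := by
  induction m generalizing a with
  | zero =>
    have : a = 0 := SkewPolynomial.ext fun i => ha i (Nat.zero_le i)
    rw [this, zero_mul]; exact zero_mem _
  | succ m ih =>
    have h1 := degreeLT_mono (e := m + 1 + d) (by omega) (ih (sub_monomial_mem ha))
    have h2 := degreeLT_mono (e := m + 1 + d) (by omega)
      (monomial_mul_mem (k := m) (a.coeff m) hg)
    have := add_mem h1 h2
    rwa [← add_mul, sub_add_cancel] at this

theorem coeff_mul_top {m d : ℕ} {a g : SkewPoly σ} (ha : a ∈ degreeLT σ (m + 1))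
    (hg : g ∈ degreeLT σ (d + 1)) :
    (a * g).coeff (m + d) = a.coeff m * SkewPolynomial.φ^[m] (g.coeff d) := by
  have h := mul_mem_degreeLT (sub_monomial_mem ha) hg (m + d) le_rfl
  rw [sub_mul, SkewPolynomial.coeff_sub, coeff_monomial_mul, sub_eq_zero] at h
  exact h

/-- Right division with remainder by a nonzero `f`: `g = h * f + r` with `deg r < deg f`, and the
remainder `r` is unique. -/
theorem existsUnique_remainder {f : SkewPoly σ} (hf : f ≠ 0) (g : SkewPoly σ) :
    ∃! r : SkewPoly σ, r ∈ degreeLT σ (natDegree f) ∧ ∃ h : SkewPoly σ, g = h * f + r := by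
  set d := natDegree f with hd
  have hfd : f ∈ degreeLT σ (d + 1) := mem_degreeLT_natDegree_succ f
  have hlc : f.coeff d ≠ 0 := coeff_natDegree_ne_zero hf
  refine existsUnique_of_exists_of_unique ?_ ?_
  · have key : ∀ N, ∀ g : SkewPoly σ, g ∈ degreeLT σ (d + N) →
        ∃ r : SkewPoly σ, r ∈ degreeLT σ d ∧ ∃ h : SkewPoly σ, g = h * f + r := by
      intro N
      induction N with
      | zero => exact fun g hg => ⟨g, hg, 0, by rw [zero_mul, zero_add]⟩
      | succ N ih =>
        intro g hg
        set c : Twist σ := g.coeff (N + d) / SkewPolynomial.φ^[N] (f.coeff d) with hc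
        have hmem : g - SkewPolynomial.monomial N c * f ∈ degreeLT σ (d + N) := by
          intro i hi
          rw [SkewPolynomial.coeff_sub]
          rcases hi.eq_or_lt with rfl | hi
          · rw [add_comm d N, coeff_monomial_mul, hc,
              div_mul_cancel₀ _ (mt iterate_phi_eq_zero.mp hlc), sub_self]
          · rw [hg i (by omega), monomial_mul_mem c hfd i (by omega), sub_self]
        obtain ⟨r, hr, h, e⟩ := ih _ hmem
        exact ⟨r, hr, h + SkewPolynomial.monomial N c, by
          rw [add_mul, add_right_comm, ← e, sub_add_cancel]⟩
    exact key (natDegree g + 1) g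
      (degreeLT_mono (by omega) (mem_degreeLT_natDegree_succ g))
  · rintro r₁ r₂ ⟨hr₁, h₁, e₁⟩ ⟨hr₂, h₂, e₂⟩
    have e : (h₁ - h₂) * f = r₂ - r₁ := by
      rw [sub_mul, sub_eq_sub_iff_add_eq_add, ← e₁, add_comm, e₂, add_comm]
    by_cases hz : h₁ - h₂ = 0
    · rw [hz, zero_mul] at e
      exact (sub_eq_zero.mp e.symm).symm
    · exfalso
      have h := coeff_mul_top (mem_degreeLT_natDegree_succ (h₁ - h₂)) hfd
      rw [e, sub_mem hr₂ hr₁ _ (Nat.le_add_left _ _)] at h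
      exact mul_ne_zero (coeff_natDegree_ne_zero hz) (mt iterate_phi_eq_zero.mp hlc) h.symm

open Classical in
/-- The remainder of `g` on right division by `f` (with the value `0` if `f = 0`). -/
def modRight (g f : SkewPoly σ) : SkewPoly σ :=
  if hf : f ≠ 0 then (existsUnique_remainder hf g).choose else 0

theorem modRight_mem (g f : SkewPoly σ) : modRight g f ∈ degreeLT σ (natDegree f) := by
  unfold modRight
  split_ifs with hf
  · exact (existsUnique_remainder hf g).choose_spec.1.1
  · exact zero_mem _

theorem modRight_spec (g : SkewPoly σ) {f : SkewPoly σ} (hf : f ≠ 0) :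
    ∃ h : SkewPoly σ, g = h * f + modRight g f := by
  unfold modRight
  rw [dif_pos hf]
  exact (existsUnique_remainder hf g).choose_spec.1.2

theorem modRight_eq {g f r : SkewPoly σ} (hf : f ≠ 0) (hr : r ∈ degreeLT σ (natDegree f))
    (h : SkewPoly σ) (e : g = h * f + r) : modRight g f = r :=
  (existsUnique_remainder hf g).unique ⟨modRight_mem g f, modRight_spec g hf⟩ ⟨hr, h, e⟩

theorem modRight_add (g₁ g₂ f : SkewPoly σ) :
    modRight (g₁ + g₂) f = modRight g₁ f + modRight g₂ f := by
  by_cases hf : f = 0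
  · simp [modRight, hf]
  · obtain ⟨h₁, e₁⟩ := modRight_spec g₁ hf
    obtain ⟨h₂, e₂⟩ := modRight_spec g₂ hf
    refine modRight_eq hf (add_mem (modRight_mem _ _) (modRight_mem _ _)) (h₁ + h₂) ?_
    rw [add_mul, add_add_add_comm, ← e₁, ← e₂]

/-- The underlying set of `𝕊_f`: the skew polynomials of degree less than `deg f`. -/
def S (f : SkewPoly σ) : Type u := degreeLT σ (natDegree f)

instance (f : SkewPoly σ) : AddCommGroup (S f) :=
  inferInstanceAs (AddCommGroup (degreeLT σ (natDegree f)))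

/-- The multiplication of `𝕊_f`: `a ∘ b` is the remainder of `a * b` on right division by `f`. -/
instance (f : SkewPoly σ) : Mul (S f) :=
  ⟨fun a b => ⟨modRight (a.1 * b.1) f, modRight_mem _ _⟩⟩

theorem S.mul_val {f : SkewPoly σ} (a b : S f) : (a * b).1 = modRight (a.1 * b.1) f := rfl

instance (f : SkewPoly σ) : NonUnitalNonAssocRing (S f) where
  left_distrib a b c := Subtype.ext <| by
    change modRight (a.1 * (b.1 + c.1)) f = modRight (a.1 * b.1) f + modRight (a.1 * c.1) f
    rw [mul_add, modRight_add]
  right_distrib a b c := Subtype.ext <| by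
    change modRight ((a.1 + b.1) * c.1) f = modRight (a.1 * c.1) f + modRight (b.1 * c.1) f
    rw [add_mul, modRight_add]
  zero_mul a := Subtype.ext <| by
    have h := modRight_add (0 * a.1) (0 * a.1) f
    rw [zero_mul, add_zero, left_eq_add] at h
    change modRight (0 * a.1) f = 0
    rw [zero_mul, h]
  mul_zero a := Subtype.ext <| by
    have h := modRight_add (a.1 * 0) (a.1 * 0) f
    rw [mul_zero, add_zero, left_eq_add] at h
    change modRight (a.1 * 0) f = 0
    rw [mul_zero, h]

/-- The left nucleus. -/
def leftNucleus (A : Type*) [Mul A] : Set A := {x | ∀ y z : A, x * (y * z) = (x * y) * z}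

/-- The middle nucleus. -/
def middleNucleus (A : Type*) [Mul A] : Set A := {y | ∀ x z : A, x * (y * z) = (x * y) * z}

/-- The right nucleus. -/
def rightNucleus (A : Type*) [Mul A] : Set A := {z | ∀ x y : A, x * (y * z) = (x * y) * z}

/-- The centre: the elements of all three nuclei which commute with all elements. -/
def centre (A : Type*) [Mul A] : Set A :=
  {x | x ∈ leftNucleus A ∩ middleNucleus A ∩ rightNucleus A ∧ ∀ y : A, x * y = y * x}

end SkewSemifield

end

namespace SkewSemifield

section

open SkewPolynomial

universe u

variable {K : Type u} [Field K] {σ : K ≃+* K}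

/-! Let `V = R/Rf`, a simple left `R`-module with `q^(nd)` elements, and let `E = End_R(V)`, a
finite field by Schur and Wedderburn. Everything reduces to `#E = q^d`. Since `t` acts bijectively
on `V`, the two-sided ideal `Ann V` is `Rg` with `g` monic and `g(0) ≠ 0`, and comparing `g * a`
with `a * g` shows `deg g = n * s`. By density `R/Rg` is `End_E(V)`, of order `q^(n * n * s)`
(`card_end_end`). The field `E` is its centre, represented by the polynomials in `t^n` over `F_q` of
degree less than `n * s`, so `#E = q^s` (`card_end`). If `dim_E V = m`, then `s * m^2 = n^2 * s`, so
`m = n` and `#V = q^(ns)`; hence `s = d`. For the nuclei, `(x, y, z)` associates iff `(xy - (xy mod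
f)) z ∈ Rf` (`assoc_iff`). When `deg x + deg y = d` the first factor is a nonzero constant times
`f`, so the condition becomes `f z ∈ Rf`. Hence the right nucleus is the eigenring of `f`, which is
in bijection with `E`. As `q^d < q^(nd)`, some `z` violates `f z ∈ Rf`, and this `z` excludes every
nonconstant element from the left and middle nuclei. The centre then consists of the constants that
commute with `t`. -/

/-! ### Coefficients and degrees of products. -/

theorem coeff_mul_monomial (p : SkewPoly σ) (k : ℕ) (c : Twist σ) (i : ℕ) :
    (p * monomial k c).coeff (i + k) = p.coeff i * φ^[i] c := by
  induction p using SkewPolynomial.induction with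
  | h0 => simp
  | ha m r q _ _ ih =>
    rw [add_mul, coeff_add, ih, coeff_add, monomial_mul_monomial, coeff_monomial, coeff_monomial,
      add_mul]
    by_cases h : m = i
    · simp [h]
    · simp [h]

theorem coeff_mul_monomial_of_lt (p : SkewPoly σ) {k i : ℕ} (c : Twist σ) (h : i < k) :
    (p * monomial k c).coeff i = 0 := by
  induction p using SkewPolynomial.induction with
  | h0 => simp
  | ha m r q _ _ ih =>
    rw [add_mul, coeff_add, ih, monomial_mul_monomial, coeff_monomial, if_neg (by omega), add_zero]

theorem coeff_monomial_mul_of_lt (p : SkewPoly σ) {k i : ℕ} (c : Twist σ) (h : i < k) :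
    (monomial k c * p : SkewPoly σ).coeff i = 0 := by
  induction p using SkewPolynomial.induction with
  | h0 => simp
  | ha m r q _ _ ih =>
    rw [mul_add, coeff_add, ih, monomial_mul_monomial, coeff_monomial, if_neg (by omega), add_zero]

theorem coeff_mul_C (p : SkewPoly σ) (c : Twist σ) (i : ℕ) :
    (p * C c).coeff i = p.coeff i * φ^[i] c := coeff_mul_monomial p 0 c i

theorem coeff_C_mul (p : SkewPoly σ) (c : Twist σ) (i : ℕ) :
    (C c * p : SkewPoly σ).coeff i = c * p.coeff i := by
  simpa using coeff_monomial_mul 0 c p i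

theorem coeff_mul_X (p : SkewPoly σ) (i : ℕ) : (p * X).coeff (i + 1) = p.coeff i := by
  rw [← monomial_one_one_eq_X, coeff_mul_monomial, ← RingHom.coe_pow, map_one, mul_one]

theorem coeff_mul_X_zero (p : SkewPoly σ) : (p * X).coeff 0 = 0 :=
  coeff_mul_monomial_of_lt p 1 one_pos

theorem coeff_X_mul (p : SkewPoly σ) (i : ℕ) :
    (X * p : SkewPoly σ).coeff (i + 1) = φ (p.coeff i) := by
  rw [← monomial_one_one_eq_X, add_comm, coeff_monomial_mul, one_mul, Function.iterate_one]

theorem coeff_X_mul_zero (p : SkewPoly σ) : (X * p : SkewPoly σ).coeff 0 = 0 :=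
  coeff_monomial_mul_of_lt p 1 one_pos

theorem coeff_eq_zero_of_natDegree_lt {p : SkewPoly σ} {i : ℕ} (h : natDegree p < i) :
    p.coeff i = 0 :=
  mem_degreeLT_natDegree_succ p i h

theorem le_natDegree_of_coeff_ne_zero {p : SkewPoly σ} {i : ℕ} (h : p.coeff i ≠ 0) :
    i ≤ natDegree p := by
  by_contra! hlt
  exact h (coeff_eq_zero_of_natDegree_lt hlt)

theorem natDegree_lt_of_mem {p : SkewPoly σ} {d : ℕ} (hd : 0 < d) (h : p ∈ degreeLT σ d) :
    natDegree p < d := by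
  by_cases hp : p = 0
  · simpa [hp, natDegree] using hd
  · exact (mem_degreeLT_iff_natDegree_lt hp).mp h

theorem mem_of_natDegree_lt {p : SkewPoly σ} {d : ℕ} (h : natDegree p < d) :
    p ∈ degreeLT σ d := degreeLT_mono h (mem_degreeLT_natDegree_succ p)

theorem coeff_mul_natDegree_add (a b : SkewPoly σ) :
    (a * b).coeff (natDegree a + natDegree b) =
      a.coeff (natDegree a) * φ^[natDegree a] (b.coeff (natDegree b)) :=
  coeff_mul_top (mem_degreeLT_natDegree_succ a) (mem_degreeLT_natDegree_succ b)

theorem coeff_mul_natDegree_add_ne_zero {a b : SkewPoly σ} (ha : a ≠ 0) (hb : b ≠ 0) :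
    (a * b).coeff (natDegree a + natDegree b) ≠ 0 := by
  rw [coeff_mul_natDegree_add]
  exact mul_ne_zero (coeff_natDegree_ne_zero ha)
    (mt iterate_phi_eq_zero.mp (coeff_natDegree_ne_zero hb))

theorem skewPoly_mul_ne_zero {a b : SkewPoly σ} (ha : a ≠ 0) (hb : b ≠ 0) : a * b ≠ 0 := by
  intro h
  apply coeff_mul_natDegree_add_ne_zero ha hb
  rw [h, coeff_zero]

theorem natDegree_mul {a b : SkewPoly σ} (ha : a ≠ 0) (hb : b ≠ 0) :
    natDegree (a * b) = natDegree a + natDegree b := by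
  apply le_antisymm
  · have h := mul_mem_degreeLT (mem_degreeLT_natDegree_succ a) (mem_degreeLT_natDegree_succ b)
    have := natDegree_lt_of_mem (by omega) h
    omega
  · exact le_natDegree_of_coeff_ne_zero (coeff_mul_natDegree_add_ne_zero ha hb)

theorem eq_C_of_mem_degreeLT_one {p : SkewPoly σ} (h : p ∈ degreeLT σ 1) : p = C (p.coeff 0) := by
  ext i
  rw [coeff_C]
  split_ifs with hi
  · rw [hi]
  · exact h i (by omega)

theorem C_inv_mul {c : Twist σ} (hc : c ≠ 0) : (C c⁻¹ * C c : SkewPoly σ) = 1 := by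
  rw [← C_mul, inv_mul_cancel₀ hc, C_1]

theorem C_mem_degreeLT (c : Twist σ) {d : ℕ} (hd : 0 < d) : (C c : SkewPoly σ) ∈ degreeLT σ d :=
  fun i hi => coeff_C_ne_zero (by omega)

theorem monomial_mem_degreeLT (c : Twist σ) {k d : ℕ} (hd : k < d) :
    (monomial k c : SkewPoly σ) ∈ degreeLT σ d :=
  fun i hi => by rw [coeff_monomial, if_neg (by omega)]

theorem coeff_finset_sum {ι : Type*} (s : Finset ι) (p : ι → SkewPoly σ) (i : ℕ) :
    (∑ j ∈ s, p j).coeff i = ∑ j ∈ s, (p j).coeff i :=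
  map_sum (AddMonoidHom.mk' (fun p : SkewPoly σ => p.coeff i) fun a b => coeff_add a b i) p s

/-- The skew polynomial with prescribed coefficients in degrees less than `d`. -/
noncomputable def ofCoeffs (d : ℕ) (c : ℕ → Twist σ) : SkewPoly σ := ∑ i ∈ Finset.range d, monomial i (c i)

theorem coeff_ofCoeffs (d : ℕ) (c : ℕ → Twist σ) (i : ℕ) :
    (ofCoeffs d c).coeff i = if i < d then c i else 0 := by
  simp [ofCoeffs, coeff_finset_sum, coeff_monomial]

/-- Skew polynomials of degree less than `d` are given by their `d` coefficients. -/
noncomputable def degreeLTEquiv (σ : K ≃+* K) (d : ℕ) : degreeLT σ d ≃ (Fin d → Twist σ) where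
  toFun p i := p.1.coeff i
  invFun c := ⟨ofCoeffs d fun i => if h : i < d then c ⟨i, h⟩ else 0, fun i hi => by
    rw [coeff_ofCoeffs, if_neg (by omega)]⟩
  left_inv p := Subtype.ext <| SkewPolynomial.ext fun i => by
    rw [coeff_ofCoeffs]
    split_ifs with h
    · rfl
    · exact (p.2 i (by omega)).symm
  right_inv c := funext fun i => by
    simp [coeff_ofCoeffs]

instance [Finite K] : Finite (Twist σ) := inferInstanceAs (Finite K)

instance [Finite K] (d : ℕ) : Finite (degreeLT σ d) := .of_equiv _ (degreeLTEquiv σ d).symm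

theorem card_degreeLT [Finite K] (d : ℕ) : Nat.card (degreeLT σ d) = Nat.card K ^ d := by
  rw [Nat.card_congr (degreeLTEquiv σ d), Nat.card_fun, Nat.card_fin]; rfl

/-! ### Left ideals and the quotients `R/Rf`. -/

theorem mem_span_singleton_iff {f p : SkewPoly σ} :
    p ∈ Submodule.span (SkewPoly σ) {f} ↔ ∃ h, p = h * f := by
  rw [Submodule.mem_span_singleton]
  exact exists_congr fun h => eq_comm

theorem eq_zero_of_mem_span {f p : SkewPoly σ} (hp : p ∈ degreeLT σ (natDegree f))
    (h : p ∈ Submodule.span (SkewPoly σ) {f}) : p = 0 := by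
  obtain ⟨g, rfl⟩ := mem_span_singleton_iff.mp h
  by_cases hf : f = 0
  · simp [hf]
  · exact (existsUnique_remainder hf (g * f)).unique ⟨hp, 0, by simp⟩ ⟨zero_mem _, g, by simp⟩

theorem sub_modRight_mem_span {f : SkewPoly σ} (hf : f ≠ 0) (g : SkewPoly σ) :
    g - modRight g f ∈ Submodule.span (SkewPoly σ) {f} := by
  obtain ⟨h, e⟩ := modRight_spec g hf
  exact mem_span_singleton_iff.mpr ⟨h, sub_eq_iff_eq_add.mpr e⟩

/-- Residue classes modulo `R f` are represented by the remainders. -/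
noncomputable def quotEquiv {f : SkewPoly σ} (hf : f ≠ 0) :
    degreeLT σ (natDegree f) ≃ (SkewPoly σ ⧸ Submodule.span (SkewPoly σ) {f}) :=
  Equiv.ofBijective (fun p => Submodule.Quotient.mk p.1) <| by
    constructor
    · intro a b h
      exact Subtype.ext <| sub_eq_zero.mp <| eq_zero_of_mem_span (sub_mem a.2 b.2) <|
        (Submodule.Quotient.eq _).mp h
    · intro v
      obtain ⟨g, rfl⟩ := Submodule.Quotient.mk_surjective _ v
      refine ⟨⟨modRight g f, modRight_mem g f⟩, ((Submodule.Quotient.eq _).mpr ?_).symm⟩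
      exact sub_modRight_mem_span hf g

theorem quotEquiv_apply {f : SkewPoly σ} (hf : f ≠ 0) (p : degreeLT σ (natDegree f)) :
    quotEquiv hf p = Submodule.Quotient.mk p.1 := rfl

theorem card_quot [Finite K] {f : SkewPoly σ} (hf : f ≠ 0) :
    Nat.card (SkewPoly σ ⧸ Submodule.span (SkewPoly σ) {f}) = Nat.card K ^ natDegree f := by
  rw [← Nat.card_congr (quotEquiv hf), card_degreeLT]

/-- Every nonzero left ideal is generated by a monic element. -/
theorem exists_monic_span_eq {I : Submodule (SkewPoly σ) (SkewPoly σ)} (hI : I ≠ ⊥) :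
    ∃ g : SkewPoly σ, g.coeff (natDegree g) = 1 ∧ I = Submodule.span (SkewPoly σ) {g} := by
  classical
  have hex : ∃ k, ∃ p ∈ I, p ≠ 0 ∧ natDegree p = k := by
    obtain ⟨p, hp, h0⟩ := I.ne_bot_iff.mp hI
    exact ⟨_, p, hp, h0, rfl⟩
  obtain ⟨p, hp, hp0, hpd⟩ := Nat.find_spec hex
  have hmin : ∀ r ∈ I, r ∈ degreeLT σ (natDegree p) → r = 0 := by
    intro r hr hrd
    by_contra hr0
    exact Nat.find_min hex (hpd ▸ (mem_degreeLT_iff_natDegree_lt hr0).mp hrd) ⟨r, hr, hr0, rfl⟩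
  have hlc := coeff_natDegree_ne_zero hp0
  have hCp : (C (p.coeff (natDegree p))⁻¹ : SkewPoly σ) ≠ 0 := by
    rw [Ne, C_eq_zero]; exact inv_ne_zero hlc
  have hC0 : natDegree (C (p.coeff (natDegree p))⁻¹ : SkewPoly σ) = 0 := by
    have := natDegree_lt_of_mem one_pos (C_mem_degreeLT (σ := σ) (p.coeff (natDegree p))⁻¹ one_pos)
    omega
  have hdeg : natDegree (C (p.coeff (natDegree p))⁻¹ * p : SkewPoly σ) = natDegree p := by
    rw [natDegree_mul hCp hp0, hC0, zero_add]
  refine ⟨C (p.coeff (natDegree p))⁻¹ * p, ?_, ?_⟩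
  · rw [hdeg, coeff_C_mul, inv_mul_cancel₀ hlc]
  · set g : SkewPoly σ := C (p.coeff (natDegree p))⁻¹ * p with hg
    have hgI : g ∈ I := I.smul_mem _ hp
    have hg0 : g ≠ 0 := skewPoly_mul_ne_zero hCp hp0
    apply le_antisymm
    · intro r hr
      have hs := sub_modRight_mem_span hg0 r
      have hle : Submodule.span (SkewPoly σ) {g} ≤ I := by
        rwa [Submodule.span_singleton_le_iff_mem]
      have : modRight r g = 0 := by
        apply hmin
        · simpa using sub_mem hr (hle hs)
        · exact hdeg ▸ modRight_mem r g
      rwa [this, sub_zero] at hs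
    · rwa [Submodule.span_singleton_le_iff_mem]

theorem span_singleton_eq_top_of_natDegree_eq_zero {g : SkewPoly σ} (hg : g ≠ 0)
    (h : natDegree g = 0) : Submodule.span (SkewPoly σ) {g} = ⊤ := by
  have hc : g = C (g.coeff 0) := eq_C_of_mem_degreeLT_one (mem_of_natDegree_lt (by omega))
  have h0 : g.coeff 0 ≠ 0 := h ▸ coeff_natDegree_ne_zero hg
  have h1 : (1 : SkewPoly σ) ∈ Submodule.span (SkewPoly σ) {g} :=
    mem_span_singleton_iff.mpr ⟨C (g.coeff 0)⁻¹, by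
      conv_rhs => rw [hc]
      rw [coeff_C_zero, C_inv_mul h0]⟩
  rw [eq_top_iff]
  intro r _
  simpa using Submodule.smul_mem _ r h1

/-- For irreducible `f` the left module `R / R f` is simple. -/
theorem isSimpleModule_quot {f : SkewPoly σ} (hf : IsIrred f) (hd : 0 < natDegree f) :
    IsSimpleModule (SkewPoly σ) (SkewPoly σ ⧸ Submodule.span (SkewPoly σ) {f}) := by
  have hf0 : f ≠ 0 := by rintro rfl; simp [natDegree] at hd
  rw [isSimpleModule_iff_isCoatom]
  constructor
  · intro h
    have h1 : (1 : SkewPoly σ) ∈ Submodule.span (SkewPoly σ) {f} := h ▸ Submodule.mem_top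
    exact one_ne_zero (eq_zero_of_mem_span (C_1 (R := Twist σ) ▸ C_mem_degreeLT 1 hd) h1)
  · intro I hI
    have hfI : f ∈ I := hI.le (Submodule.mem_span_singleton_self f)
    obtain ⟨g, -, rfl⟩ := exists_monic_span_eq (I := I) (ne_bot_of_gt hI)
    obtain ⟨a, ha⟩ := mem_span_singleton_iff.mp hfI
    have ha0 : a ≠ 0 := by rintro rfl; simp [hf0] at ha
    have hg0 : g ≠ 0 := by rintro rfl; simp [hf0] at ha
    have hdeg : natDegree f = natDegree a + natDegree g := ha ▸ natDegree_mul ha0 hg0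
    rcases Nat.eq_zero_or_pos (natDegree g) with h | h
    · exact span_singleton_eq_top_of_natDegree_eq_zero hg0 h
    -- If `a` is constant it is a unit, so `g ∈ Rf`, against the strict inclusion of `Rf` in `Rg`.
    rcases Nat.eq_zero_or_pos (natDegree a) with h' | h'
    · exfalso
      refine hI.not_ge ?_
      rw [Submodule.span_singleton_le_iff_mem, mem_span_singleton_iff]
      have h1 : (1 : SkewPoly σ) ∈ Submodule.span (SkewPoly σ) {a} := by
        rw [span_singleton_eq_top_of_natDegree_eq_zero ha0 h']; trivial
      obtain ⟨b, hb⟩ := mem_span_singleton_iff.mp h1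
      exact ⟨b, by rw [ha, ← mul_assoc, ← hb, one_mul]⟩
    · exact absurd ⟨a, g, by omega, by omega, ha⟩ hf

/-! ### Commutation with `t` and with constants. -/

theorem exists_eq_mul_X {p : SkewPoly σ} (h : p.coeff 0 = 0) : ∃ r, p = r * X := by
  refine ⟨ofCoeffs (natDegree p) fun i => p.coeff (i + 1), SkewPolynomial.ext fun i => ?_⟩
  cases i with
  | zero => rw [coeff_mul_X_zero, h]
  | succ i =>
    rw [coeff_mul_X, coeff_ofCoeffs]
    split_ifs with hi
    · rfl
    · exact coeff_eq_zero_of_natDegree_lt (by omega)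

/-- Against a monomial `c t^k`, the two products have coefficients `r_i σ^i(c)` and `c σ^k(r_i)` at
`t^(i+k)`; the hypotheses remove both twists. -/
theorem mul_comm_of_coeff {n : ℕ} (hσ : ∀ i, n ∣ i → ∀ a : Twist σ, φ^[i] a = a) {r : SkewPoly σ}
    (hF : ∀ i, φ (r.coeff i) = r.coeff i) (hn : ∀ i, r.coeff i ≠ 0 → n ∣ i) (p : SkewPoly σ) :
    r * p = p * r := by
  induction p using SkewPolynomial.induction with
  | h0 => simp
  | ha k c q _ _ ih =>
    rw [mul_add, add_mul, ih]
    congr 1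
    ext i
    rcases lt_or_ge i k with h | h
    · rw [coeff_mul_monomial_of_lt _ _ h, coeff_monomial_mul_of_lt _ _ h]
    · obtain ⟨i, rfl⟩ := Nat.exists_eq_add_of_le' h
      have hk : φ^[k] (r.coeff i) = r.coeff i := Function.iterate_fixed (hF i) k
      rw [coeff_mul_monomial, add_comm i k, coeff_monomial_mul, hk, mul_comm]
      by_cases h0 : r.coeff i = 0
      · simp [h0]
      · rw [hσ i (hn i h0)]

theorem iterate_phi_eq_of_mul_C {p : SkewPoly σ} {a b : Twist σ} (h : p * C a = C b * p) {i : ℕ}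
    (hi : p.coeff i ≠ 0) : φ^[i] a = b := by
  have := congrArg (fun p => coeff p i) h
  simp only [coeff_mul_C, coeff_C_mul] at this
  rw [mul_comm] at this
  exact mul_right_cancel₀ hi this

theorem phi_coeff_eq_of_X_mul {p : SkewPoly σ} (h : X * p = p * X) (i : ℕ) :
    φ (p.coeff i) = p.coeff i := by
  have := congrArg (fun p => coeff p (i + 1)) h
  simpa only [coeff_X_mul, coeff_mul_X] using this

/-- The twist `φ^[d]` is the one that cancels the terms of degree `d`. -/
theorem mul_C_sub_C_mul_mem (p : SkewPoly σ) {d : ℕ} (hp : p ∈ degreeLT σ (d + 1)) (a : Twist σ) :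
    p * C a - C (φ^[d] a) * p ∈ degreeLT σ d := by
  intro i hi
  rw [coeff_sub, coeff_mul_C, coeff_C_mul]
  rcases hi.eq_or_lt with rfl | hi
  · rw [mul_comm, sub_self]
  · rw [hp i hi, zero_mul, mul_zero, sub_zero]

/-- An element of `Rg` of degree at most `deg g` is `c g` with `c` constant, and its constant term
`c g(0)` vanishes only for `c = 0`. This handles commutators with `t`, whose degree may reach `deg
g`. -/
theorem eq_zero_of_mem_span_of_coeff_zero {g u : SkewPoly σ} (hg : g.coeff (natDegree g) = 1)
    (hg0 : g.coeff 0 ≠ 0) (hu : u ∈ Submodule.span (SkewPoly σ) {g})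
    (hud : u ∈ degreeLT σ (natDegree g + 1)) (hu0 : u.coeff 0 = 0) : u = 0 := by
  have h : u - C (u.coeff (natDegree g)) * g = 0 := by
    apply eq_zero_of_mem_span (f := g)
    · intro i hi
      rw [coeff_sub, coeff_C_mul]
      rcases hi.eq_or_lt with rfl | hi
      · rw [hg, mul_one, sub_self]
      · rw [hud i hi, coeff_eq_zero_of_natDegree_lt hi, mul_zero, sub_zero]
    · exact sub_mem hu (Submodule.smul_mem _ _ (Submodule.mem_span_singleton_self g))
  have h0 := congrArg (fun p => coeff p 0) h
  simp only [coeff_sub, coeff_C_mul, hu0, coeff_zero, zero_sub, neg_eq_zero] at h0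
  have h1 := (mul_eq_zero.mp h0).resolve_right hg0
  rwa [h1, C_0, zero_mul, sub_zero] at h

/-- The degree of a generator, with nonzero constant term, of a two-sided ideal is divisible by the
order of `σ`. -/
theorem dvd_natDegree_of_span_twoSided {n : ℕ} (hσ : ∀ i, (∀ a : Twist σ, φ^[i] a = a) ↔ n ∣ i)
    {g : SkewPoly σ} (hg0 : g.coeff 0 ≠ 0)
    (htwo : ∀ r : SkewPoly σ, g * r ∈ Submodule.span (SkewPoly σ) {g}) :
    n ∣ natDegree g := by
  have hself := Submodule.mem_span_singleton_self (R := SkewPoly σ) g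
  rw [← hσ]
  intro a
  -- This difference lies in `Rg` but has degree below `deg g`. Its vanishing, read at the nonzero
  -- constant term of `g`, gives `σ^(deg g)(a) = a`.
  have h : g * C a - C (φ^[natDegree g] a) * g = 0 :=
    eq_zero_of_mem_span (mul_C_sub_C_mul_mem g (mem_degreeLT_natDegree_succ g) a)
      (sub_mem (htwo _) (Submodule.smul_mem _ _ hself))
  exact (iterate_phi_eq_of_mul_C (sub_eq_zero.mp h) hg0).symm

/-! ### The annihilator of a finite simple module. -/

section Module

variable {V : Type*} [AddCommGroup V] [Module (SkewPoly σ) V]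

theorem exists_X_mul_eq (r : SkewPoly σ) : ∃ r', X * r = r' * X :=
  exists_eq_mul_X (coeff_X_mul_zero r)

/-- The kernel of `t` is a submodule because `tR ⊆ Rt`; simplicity makes it zero. -/
theorem X_smul_injective [IsSimpleModule (SkewPoly σ) V]
    (hX : ∃ v : V, (X : SkewPoly σ) • v ≠ 0) :
    Function.Injective fun v : V => (X : SkewPoly σ) • v := by
  let N : Submodule (SkewPoly σ) V :=
    { carrier := {v | (X : SkewPoly σ) • v = 0}
      add_mem' := fun {a b} (ha : _ = _) (hb : _ = _) => by
        change (X : SkewPoly σ) • (a + b) = 0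
        rw [smul_add, ha, hb, add_zero]
      zero_mem' := smul_zero _
      smul_mem' := fun r v (hv : _ = _) => by
        change (X : SkewPoly σ) • r • v = 0
        obtain ⟨r', h⟩ := exists_X_mul_eq r
        rw [← mul_smul, h, mul_smul, hv, smul_zero] }
  have hN : N = ⊥ := by
    refine (eq_bot_or_eq_top N).resolve_right fun h => ?_
    obtain ⟨v, hv⟩ := hX
    exact hv (show v ∈ N from h ▸ Submodule.mem_top)
  intro v w h
  have : v - w ∈ N := by
    change (X : SkewPoly σ) • (v - w) = 0
    rw [smul_sub]; exact sub_eq_zero.mpr h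
  rw [hN, Submodule.mem_bot] at this
  exact sub_eq_zero.mp this

/-- Two powers of `t` induce the same map on the finite set `V`, so their difference annihilates it.
-/
theorem annihilator_ne_bot [Finite V] : Module.annihilator (SkewPoly σ) V ≠ ⊥ := by
  obtain ⟨i, j, hij, h⟩ := Finite.exists_ne_map_eq_of_infinite
    fun (i : ℕ) (v : V) => (monomial i 1 : SkewPoly σ) • v
  rw [Submodule.ne_bot_iff]
  refine ⟨monomial i 1 - monomial j 1, ?_, fun h0 => ?_⟩
  · rw [Module.mem_annihilator]
    intro v
    rw [sub_smul]
    exact sub_eq_zero.mpr (congrFun h v)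
  · have := congrArg (fun p => coeff p i) h0
    simp only [coeff_sub, coeff_monomial, if_neg hij.symm, coeff_zero] at this
    simp at this

/-- The annihilator of a finite simple module on which `t` acts nontrivially. -/
theorem exists_annihilator_eq_span [Finite V] [IsSimpleModule (SkewPoly σ) V]
    (hX : ∃ v : V, (X : SkewPoly σ) • v ≠ 0) :
    ∃ g : SkewPoly σ, g.coeff (natDegree g) = 1 ∧ g.coeff 0 ≠ 0 ∧
      Module.annihilator (SkewPoly σ) V = Submodule.span (SkewPoly σ) {g} := by
  obtain ⟨g, hg, hspan⟩ := exists_monic_span_eq (annihilator_ne_bot (σ := σ) (V := V))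
  refine ⟨g, hg, fun h0 => ?_, hspan⟩
  obtain ⟨r, hr⟩ := exists_eq_mul_X h0
  have hg0 : g ≠ 0 := by
    rintro rfl
    simp at hg
  have hr0 : r ≠ 0 := by
    rintro rfl
    rw [zero_mul] at hr
    exact hg0 hr
  have hgV : ∀ v : V, g • v = 0 := Module.mem_annihilator.mp
    (hspan ▸ Submodule.mem_span_singleton_self g)
  have hsurj := Finite.injective_iff_surjective.mp (X_smul_injective hX)
  -- Since `g = r t` kills `V` and `t` is surjective on `V`, already `r` kills `V`; but its degree
  -- is too small for a nonzero element of `Rg`.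
  have hrV : r ∈ Module.annihilator (SkewPoly σ) V := by
    rw [Module.mem_annihilator]
    intro v
    obtain ⟨w, rfl⟩ := hsurj v
    dsimp only
    rw [← mul_smul, ← hr, hgV]
  rw [hspan] at hrV
  refine hr0 (eq_zero_of_mem_span ?_ hrV)
  intro i hi
  rw [← coeff_mul_X, ← hr]
  exact coeff_eq_zero_of_natDegree_lt (by omega)

end Module

/-! ### Counting central polynomials and endomorphisms. -/

/-- The central skew polynomials of degree less than `n * s`: polynomials in `t ^ n` with
coefficients fixed by `σ`. -/
def centralLT (σ : K ≃+* K) (n s : ℕ) : Set (SkewPoly σ) :=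
  {r | r ∈ degreeLT σ (n * s) ∧ (∀ i, φ (r.coeff i) = r.coeff i) ∧ ∀ i, r.coeff i ≠ 0 → n ∣ i}

theorem card_centralLT {n : ℕ} (hn : 0 < n) (s : ℕ) :
    Nat.card (centralLT σ n s) = Nat.card {a : Twist σ // φ a = a} ^ s := by
  rw [← Nat.card_fin s, ← Nat.card_fun, Nat.card_fin]
  refine Nat.card_congr
    { toFun := fun r j => ⟨r.1.coeff (n * j), r.2.2.1 _⟩
      invFun := fun c => ⟨ofCoeffs (n * s)
        fun i => if h : n ∣ i ∧ i / n < s then (c ⟨i / n, h.2⟩).1 else 0, ?_, ?_, ?_⟩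
      left_inv := ?_
      right_inv := ?_ }
  · intro i hi
    rw [coeff_ofCoeffs, if_neg (by omega)]
  · intro i
    rw [coeff_ofCoeffs]
    split_ifs with h h'
    · exact (c _).2
    · exact map_zero _
    · exact map_zero _
  · intro i hi
    by_contra h
    apply hi
    rw [coeff_ofCoeffs, dif_neg (fun h' => h h'.1), ite_self]
  · rintro ⟨r, hr⟩
    refine Subtype.ext (SkewPolynomial.ext fun i => ?_)
    dsimp only
    rw [coeff_ofCoeffs]
    split_ifs with h h'
    · rw [Nat.mul_div_cancel' h'.1]
    · by_contra hne
      exact h' ⟨hr.2.2 i (Ne.symm hne), Nat.div_lt_of_lt_mul h⟩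
    · exact (hr.1 i (by omega)).symm
  · intro c
    funext j
    refine Subtype.ext ?_
    dsimp only
    rw [coeff_ofCoeffs, if_pos (Nat.mul_lt_mul_of_pos_left j.2 hn), dif_pos
      ⟨dvd_mul_right _ _, by rw [Nat.mul_div_cancel_left _ hn]; exact j.2⟩]
    congr 2
    exact Fin.ext (Nat.mul_div_cancel_left _ hn)

theorem exists_card_eq_pow_and_card_end_eq_pow (E : Type*) [Ring E] [Finite E] (hE : IsField E)
    (V : Type*) [AddCommGroup V] [Module E V] [Finite V] :
    ∃ m, Nat.card V = Nat.card E ^ m ∧ Nat.card (Module.End E V) = Nat.card E ^ (m * m) := by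
  let := hE.toField
  have : Module.Finite E V := Module.Finite.of_finite
  refine ⟨Module.finrank E V, Module.natCard_eq_pow_finrank, ?_⟩
  rw [← Module.finrank_linearMap E E V V]
  exact Module.natCard_eq_pow_finrank (K := E) (V := V →ₗ[E] V)

/-! ### The endomorphism field and the size of a simple module. -/

section Endomorphisms

variable {V : Type*} [AddCommGroup V] [Module (SkewPoly σ) V]

instance [Finite V] : Finite (Module.End (SkewPoly σ) V) :=
  Finite.of_injective (fun e v => e v) DFunLike.coe_injective

/-- Schur's lemma gives a division ring, and Wedderburn's little theorem makes it commutative. -/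
theorem isField_end [Finite V] [IsSimpleModule (SkewPoly σ) V] :
    IsField (Module.End (SkewPoly σ) V) := by
  classical
  exact Finite.isDomain_to_isField _

/-- Density: every additive map which commutes with all endomorphisms is the action of a skew
polynomial. -/
theorem exists_smul_eq_of_end [Finite V] [IsSimpleModule (SkewPoly σ) V]
    (f : Module.End (Module.End (SkewPoly σ) V) V) : ∃ r : SkewPoly σ, ∀ v, f v = r • v := by
  obtain ⟨s⟩ := nonempty_fintype V
  obtain ⟨r, hr⟩ := jacobson_density f (Finset.univ : Finset V)
  exact ⟨r, fun v => hr v (Finset.mem_univ v)⟩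

theorem modRight_smul
    {g : SkewPoly σ}
    (hspan : Module.annihilator (SkewPoly σ) V = Submodule.span (SkewPoly σ) {g})
    (hg : g ≠ 0) (r : SkewPoly σ) (v : V) : modRight r g • v = r • v := by
  have h := sub_modRight_mem_span hg r
  rw [← hspan] at h
  have := Module.mem_annihilator.mp h v
  rw [sub_smul, sub_eq_zero] at this
  exact this.symm

theorem eq_of_forall_smul_eq
    {g : SkewPoly σ}
    (hspan : Module.annihilator (SkewPoly σ) V = Submodule.span (SkewPoly σ) {g})
    {r s : SkewPoly σ} (hr : r ∈ degreeLT σ (natDegree g))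
    (hs : s ∈ degreeLT σ (natDegree g)) (h : ∀ v : V, r • v = s • v) : r = s := by
  refine sub_eq_zero.mp (eq_zero_of_mem_span (sub_mem hr hs) ?_)
  rw [← hspan, Module.mem_annihilator]
  intro v
  rw [sub_smul, h, sub_self]

/-- The action identifies `R / Ann V` with `End_E(V)`: it is faithful modulo `Rg`, and surjective by
density. -/
theorem card_end_end [Finite K] [Finite V] [IsSimpleModule (SkewPoly σ) V]
    {g : SkewPoly σ}
    (hspan : Module.annihilator (SkewPoly σ) V = Submodule.span (SkewPoly σ) {g})
    (hg : g ≠ 0) :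
    Nat.card (Module.End (Module.End (SkewPoly σ) V) V) = Nat.card K ^ natDegree g := by
  rw [← card_degreeLT (σ := σ)]
  refine (Nat.card_congr (Equiv.ofBijective
    (fun r : degreeLT σ (natDegree g) => Module.toModuleEnd (Module.End (SkewPoly σ) V) V r.1)
    ⟨?_, ?_⟩)).symm
  · intro r s h
    exact Subtype.ext (eq_of_forall_smul_eq hspan r.2 s.2 fun v => LinearMap.congr_fun h v)
  · intro f
    obtain ⟨r, hr⟩ := exists_smul_eq_of_end f
    refine ⟨⟨modRight r g, modRight_mem r g⟩, LinearMap.ext fun v => ?_⟩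
    rw [hr]
    exact modRight_smul hspan hg r v

/-- As `E` is commutative, its elements are `E`-linear, so by density each is the action of some `r`
with `deg r < deg g`. Commutators of `r` with `t` and with constants lie in `Rg`, and are so small
that they vanish: `r` is central in `R` itself, not just modulo `Rg`. -/
theorem card_end [Finite V] [IsSimpleModule (SkewPoly σ) V]
    {g : SkewPoly σ}
    (hspan : Module.annihilator (SkewPoly σ) V = Submodule.span (SkewPoly σ) {g}) {n s : ℕ}
    (hσ : ∀ i, (∀ a : Twist σ, φ^[i] a = a) ↔ n ∣ i) (hg : g.coeff (natDegree g) = 1)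
    (hg0 : g.coeff 0 ≠ 0) (hs : natDegree g = n * s) :
    Nat.card (Module.End (SkewPoly σ) V) = Nat.card (centralLT σ n s) := by
  have hgne : g ≠ 0 := by rintro rfl; simp at hg
  refine (Nat.card_congr (Equiv.ofBijective (fun r : centralLT σ n s =>
    ({ toFun := fun v => r.1 • v
       map_add' := smul_add _
       map_smul' := fun p v => by
        rw [RingHom.id_apply, ← mul_smul, ← mul_smul, mul_comm_of_coeff (fun i => (hσ i).mpr)
          r.2.2.1 r.2.2.2] } : Module.End (SkewPoly σ) V)) ⟨?_, ?_⟩)).symm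
  · intro r s h
    exact Subtype.ext (eq_of_forall_smul_eq hspan (hs ▸ r.2.1) (hs ▸ s.2.1)
      fun v => LinearMap.congr_fun h v)
  · intro e
    obtain ⟨r, hr⟩ := exists_smul_eq_of_end (σ := σ) (V := V)
      { toFun := e
        map_add' := map_add e
        map_smul' := fun e' v => LinearMap.congr_fun (isField_end.mul_comm e e') v }
    have he : ∀ v, e v = modRight r g • v := fun v =>
      (hr v).trans (modRight_smul hspan hgne r v).symm
    have hcomm : ∀ p : SkewPoly σ,
        modRight r g * p - p * modRight r g ∈ Submodule.span (SkewPoly σ) {g} := by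
      intro p
      rw [← hspan, Module.mem_annihilator]
      intro v
      rw [sub_smul, mul_smul, mul_smul, ← he, ← he, map_smul, sub_self]
    have hmem := modRight_mem r g
    refine ⟨⟨modRight r g, hs ▸ hmem, ?_, ?_⟩, LinearMap.ext fun v => (he v).symm⟩
    · have h : modRight r g * X - X * modRight r g = 0 := by
        refine eq_zero_of_mem_span_of_coeff_zero hg hg0 (hcomm X) ?_ ?_
        · intro i hi
          obtain ⟨i, rfl⟩ := Nat.exists_eq_add_of_le' (Nat.one_le_of_lt hi)
          rw [coeff_sub, coeff_mul_X, coeff_X_mul, hmem i (by omega), map_zero, sub_zero]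
        · rw [coeff_sub, coeff_mul_X_zero, coeff_X_mul_zero, sub_zero]
      exact phi_coeff_eq_of_X_mul (sub_eq_zero.mp h).symm
    · intro i hi
      rw [← hσ]
      intro a
      have h : modRight r g * C a - C a * modRight r g = 0 := by
        refine eq_zero_of_mem_span (fun i hi => ?_) (hcomm (C a))
        rw [coeff_sub, coeff_mul_C, coeff_C_mul, hmem i hi, zero_mul, mul_zero, sub_zero]
      exact iterate_phi_eq_of_mul_C (sub_eq_zero.mp h) hi

/-- The cardinalities of a finite simple module on which `t` acts nontrivially, and of its
endomorphism field. -/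
theorem exists_card_simple_eq [Finite K] [Finite V] [IsSimpleModule (SkewPoly σ) V] {n q : ℕ}
    (hn : 0 < n) (hσ : ∀ i, (∀ a : Twist σ, φ^[i] a = a) ↔ n ∣ i)
    (hq : Nat.card {a : Twist σ // φ a = a} = q) (hK : Nat.card K = q ^ n)
    (hX : ∃ v : V, (X : SkewPoly σ) • v ≠ 0) :
    ∃ s, Nat.card (Module.End (SkewPoly σ) V) = q ^ s ∧ Nat.card V = q ^ (n * s) := by
  obtain ⟨g, hg, hg0, hspan⟩ := exists_annihilator_eq_span hX
  have hgne : g ≠ 0 := by rintro rfl; simp at hg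
  have hq1 : 1 < q := by
    have : 1 < Nat.card K := Finite.one_lt_card
    rw [hK] at this
    exact (Nat.one_lt_pow_iff hn.ne').mp this
  obtain ⟨s, hs⟩ := dvd_natDegree_of_span_twoSided hσ hg0 fun r => by
    rw [← hspan, Module.mem_annihilator]
    intro v
    rw [mul_smul]
    exact Module.mem_annihilator.mp (hspan ▸ Submodule.mem_span_singleton_self g) _
  have hE := card_end hspan hσ hg hg0 hs
  rw [card_centralLT hn, hq] at hE
  obtain ⟨m, hV, hEE⟩ := exists_card_eq_pow_and_card_end_eq_pow _
    (isField_end (σ := σ) (V := V)) V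
  refine ⟨s, hE, ?_⟩
  rw [card_end_end hspan hgne, hE, hK, ← pow_mul, ← pow_mul, hs] at hEE
  -- Both counts of `End_E(V)` are powers of `q`; their exponents give `n * (n * s) = s * (m * m)`.
  have h := Nat.pow_right_injective hq1 hEE
  have hs0 : 0 < s := by
    obtain ⟨x, y, hxy⟩ := (isField_end (σ := σ) (V := V)).exists_pair_ne
    have : Nontrivial (Module.End (SkewPoly σ) V) := ⟨x, y, hxy⟩
    have : 1 < q ^ s := hE ▸ Finite.one_lt_card
    rcases Nat.eq_zero_or_pos s with rfl | h0
    · simp at this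
    · exact h0
  have hm : m = n := by
    have h2 : s * (m * m) = s * (n * n) := by rw [← h]; ring
    exact Nat.mul_self_inj.mp (Nat.eq_of_mul_eq_mul_left hs0 h2)
  rw [hV, hE, ← pow_mul, hm, mul_comm]

end Endomorphisms

/-! ### The order of `σ`. -/

theorem iterate_phi_apply (i : ℕ) (a : Twist σ) : φ^[i] a = (σ ^ i : K ≃+* K) (a : K) := by
  rw [φ_iterate_apply]; rfl

/-- The order of `σ` is the degree of `K` over the fixed field. -/
theorem orderOf_eq [Finite K] {q n : ℕ} (hq : Nat.card {a : K // σ a = a} = q)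
    (hK : Nat.card K = q ^ n) : orderOf σ = n := by
  let G := Subgroup.zpowers (σ : RingAut K)
  have : Finite (RingAut K) := Finite.of_injective (fun e : K ≃+* K => (e : K → K))
    DFunLike.coe_injective
  let := Fintype.ofFinite G
  have hfix : Nat.card (FixedPoints.subfield G K) = q := by
    rw [← hq]
    refine Nat.card_congr (Equiv.subtypeEquivRight fun a => ?_)
    constructor
    · intro h
      exact h ⟨σ, Subgroup.mem_zpowers σ⟩
    · rintro h ⟨g, hg⟩
      have hle : Subgroup.zpowers (σ : RingAut K) ≤ MulAction.stabilizer (RingAut K) a := by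
        rw [Subgroup.zpowers_le]
        exact h
      exact hle hg
  -- By Artin's theorem the dimension of `K` over the fixed field of `⟨σ⟩` is the order of that
  -- group.
  have hcard := Module.natCard_eq_pow_finrank (K := FixedPoints.subfield G K) (V := K)
  rw [FixedPoints.finrank_eq_card G K, hfix, hK, ← Nat.card_eq_fintype_card, Nat.card_zpowers]
    at hcard
  have hq1 : 1 < q := by
    rw [← hfix]
    exact Finite.one_lt_card
  exact (Nat.pow_right_injective hq1 hcard).symm

theorem forall_iterate_phi_eq_iff [Finite K] {q n : ℕ} (hq : Nat.card {a : K // σ a = a} = q)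
    (hK : Nat.card K = q ^ n) (i : ℕ) : (∀ a : Twist σ, φ^[i] a = a) ↔ n ∣ i := by
  rw [← orderOf_eq hq hK, orderOf_dvd_iff_pow_eq_one]
  constructor
  · intro h
    exact RingEquiv.ext fun a => (iterate_phi_apply i a).symm.trans (h a)
  · intro h a
    rw [iterate_phi_apply, h]
    rfl

/-! ### The nuclei and the centre of `𝕊_f`. -/

section Nuclei

variable {f : SkewPoly σ}

theorem modRight_eq_iff (hf : f ≠ 0) {a b : SkewPoly σ} :
    modRight a f = modRight b f ↔ a - b ∈ Submodule.span (SkewPoly σ) {f} := by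
  obtain ⟨h₁, e₁⟩ := modRight_spec a hf
  obtain ⟨h₂, e₂⟩ := modRight_spec b hf
  rw [mem_span_singleton_iff]
  constructor
  · intro h
    refine ⟨h₁ - h₂, ?_⟩
    nth_rewrite 1 [e₁]
    nth_rewrite 1 [e₂]
    rw [h, sub_mul]
    abel
  · rintro ⟨h, e⟩
    refine modRight_eq hf (modRight_mem b f) (h + h₂) ?_
    rw [add_mul, add_assoc, ← e₂, ← e, sub_add_cancel]

theorem modRight_of_mem (hf : f ≠ 0) {a : SkewPoly σ} (ha : a ∈ degreeLT σ (natDegree f)) :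
    modRight a f = a :=
  modRight_eq hf ha 0 (by simp)

/-- Reducing `yz` before multiplying by `x` changes nothing modulo the left ideal `Rf`; only the
reduction of `xy`, which is then multiplied on the right, can break associativity. -/
theorem assoc_iff (hf : f ≠ 0) (x y z : S f) :
    x * (y * z) = (x * y) * z ↔
      (x.1 * y.1 - modRight (x.1 * y.1) f) * z.1 ∈ Submodule.span (SkewPoly σ) {f} := by
  have h : x * (y * z) = (x * y) * z ↔ modRight (x.1 * modRight (y.1 * z.1) f) f =
      modRight (modRight (x.1 * y.1) f * z.1) f := Subtype.ext_iff
  have e : x.1 * modRight (y.1 * z.1) f - modRight (x.1 * y.1) f * z.1 =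
      (x.1 * y.1 - modRight (x.1 * y.1) f) * z.1 -
        x.1 * (y.1 * z.1 - modRight (y.1 * z.1) f) := by
    rw [sub_mul, mul_sub, mul_assoc]; abel
  rw [h, modRight_eq_iff hf, e]
  exact Submodule.sub_mem_iff_left _ (Submodule.smul_mem _ _ (sub_modRight_mem_span hf _))

theorem assoc_of_mul_mem (hf : f ≠ 0) {x y : S f}
    (h : x.1 * y.1 ∈ degreeLT σ (natDegree f)) (z : S f) : x * (y * z) = (x * y) * z := by
  rw [assoc_iff hf, modRight_of_mem hf h, sub_self, zero_mul]
  exact zero_mem _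

/-- As `xy` has degree exactly `deg f`, the quotient of its division by `f` is a nonzero constant
`c`, and associativity says `c f z ∈ Rf`. -/
theorem mul_mem_span_of_assoc (hf : f ≠ 0) {x y z : S f} (hx : x.1 ≠ 0) (hy : y.1 ≠ 0)
    (hd : natDegree x.1 + natDegree y.1 = natDegree f) (h : x * (y * z) = (x * y) * z) :
    f * z.1 ∈ Submodule.span (SkewPoly σ) {f} := by
  rw [assoc_iff hf] at h
  obtain ⟨r, hr⟩ := modRight_spec (x.1 * y.1) hf
  rw [sub_eq_of_eq_add hr] at h
  have hr0 : r ≠ 0 := by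
    rintro rfl
    rw [zero_mul, zero_add] at hr
    have h1 := modRight_mem (x.1 * y.1) f _ le_rfl
    rw [← hr] at h1
    apply coeff_mul_natDegree_add_ne_zero hx hy
    rw [hd, h1]
  have hdeg : natDegree r = 0 := by
    by_contra hne
    apply coeff_mul_natDegree_add_ne_zero hr0 hf
    rw [← sub_eq_of_eq_add hr, coeff_sub, modRight_mem _ _ _ (by omega), sub_zero]
    apply coeff_eq_zero_of_natDegree_lt
    rw [natDegree_mul hx hy]
    omega
  obtain ⟨c, rfl⟩ : ∃ c, r = C c :=
    ⟨_, eq_C_of_mem_degreeLT_one (mem_of_natDegree_lt (by omega))⟩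
  have hc : c ≠ 0 := by rwa [Ne, C_eq_zero] at hr0
  have := Submodule.smul_mem _ (C c⁻¹ : SkewPoly σ) h
  rwa [smul_eq_mul, ← mul_assoc, ← mul_assoc, C_inv_mul hc, one_mul] at this

theorem natDegree_monomial {k : ℕ} {c : Twist σ} (hc : c ≠ 0) :
    natDegree (monomial k c : SkewPoly σ) = k := by
  rw [natDegree, support_monomial k hc, Finset.sup_singleton, id]

/-- The monomial `t ^ k` as an element of `𝕊_f`. -/
noncomputable def S.monomial {k : ℕ} (hk : k < natDegree f) : S f :=
  ⟨SkewPolynomial.monomial k 1, monomial_mem_degreeLT 1 hk⟩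

theorem S.monomial_val {k : ℕ} (hk : k < natDegree f) :
    (S.monomial hk).1 = SkewPolynomial.monomial k 1 := rfl

theorem S.monomial_val_ne_zero {k : ℕ} (hk : k < natDegree f) : (S.monomial hk).1 ≠ 0 := by
  rw [S.monomial_val, Ne, monomial_eq_zero_iff]; exact one_ne_zero

theorem S.natDegree_monomial_val {k : ℕ} (hk : k < natDegree f) :
    natDegree (S.monomial hk).1 = k := natDegree_monomial one_ne_zero

/-- The constants in `𝕊_f`. -/
noncomputable def S.C (hd : 0 < natDegree f) (c : Twist σ) : S f :=
  ⟨SkewPolynomial.C c, C_mem_degreeLT c hd⟩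

theorem S.C_val (hd : 0 < natDegree f) (c : Twist σ) : (S.C hd c).1 = SkewPolynomial.C c := rfl

theorem S.C_injective (hd : 0 < natDegree f) : Function.Injective (S.C hd) := fun _ _ h =>
  SkewPolynomial.C_injective (congrArg Subtype.val h)

theorem C_mul_mem_degreeLT {p : SkewPoly σ} {d : ℕ} (hp : p ∈ degreeLT σ d) (c : Twist σ) :
    C c * p ∈ degreeLT σ d := fun i hi => by rw [coeff_C_mul, hp i hi, mul_zero]

theorem mul_C_mem_degreeLT {p : SkewPoly σ} {d : ℕ} (hp : p ∈ degreeLT σ d) (c : Twist σ) :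
    p * C c ∈ degreeLT σ d := fun i hi => by rw [coeff_mul_C, hp i hi, zero_mul]

theorem S.eq_C_of_natDegree_eq_zero (hd : 0 < natDegree f) {x : S f} (h : natDegree x.1 = 0) :
    ∃ c, S.C hd c = x :=
  ⟨x.1.coeff 0, Subtype.ext
    (eq_C_of_mem_degreeLT_one (mem_of_natDegree_lt (d := 1) (by omega))).symm⟩

/-- A nonconstant `x` fails with `y = t^(deg f - deg x)` and the given `z`. For constant `x` the
product `xy` needs no reduction. -/
theorem leftNucleus_eq (hd : 0 < natDegree f)
    (hf : ∃ z : S f, f * z.1 ∉ Submodule.span (SkewPoly σ) {f}) :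
    leftNucleus (S f) = Set.range (S.C hd) := by
  have hf0 : f ≠ 0 := by rintro rfl; simp [natDegree] at hd
  ext x
  constructor
  · intro hx
    apply S.eq_C_of_natDegree_eq_zero
    by_contra hne
    obtain ⟨z, hz⟩ := hf
    have hx0 : x.1 ≠ 0 := by intro h; rw [h] at hne; simp [natDegree] at hne
    have hlt := natDegree_lt_of_mem hd x.2
    have hk : natDegree f - natDegree x.1 < natDegree f := by omega
    exact hz (mul_mem_span_of_assoc hf0 hx0 (S.monomial_val_ne_zero hk)
      (by rw [S.natDegree_monomial_val]; omega) (hx _ z))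
  · rintro ⟨c, rfl⟩ y z
    exact assoc_of_mul_mem (x := S.C hd c) (y := y) hf0 (C_mul_mem_degreeLT y.2 c) z

theorem middleNucleus_eq (hd : 0 < natDegree f)
    (hf : ∃ z : S f, f * z.1 ∉ Submodule.span (SkewPoly σ) {f}) :
    middleNucleus (S f) = Set.range (S.C hd) := by
  have hf0 : f ≠ 0 := by rintro rfl; simp [natDegree] at hd
  ext x
  constructor
  · intro hx
    apply S.eq_C_of_natDegree_eq_zero
    by_contra hne
    obtain ⟨z, hz⟩ := hf
    have hx0 : x.1 ≠ 0 := by intro h; rw [h] at hne; simp [natDegree] at hne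
    have hlt := natDegree_lt_of_mem hd x.2
    have hk : natDegree f - natDegree x.1 < natDegree f := by omega
    exact hz (mul_mem_span_of_assoc hf0 (S.monomial_val_ne_zero hk) hx0
      (by rw [S.natDegree_monomial_val]; omega) (hx _ z))
  · rintro ⟨c, rfl⟩ y z
    exact assoc_of_mul_mem (x := y) (y := S.C hd c) hf0 (mul_C_mem_degreeLT y.2 c) z

/-- The bound on the degree allows the test pair `t`, `t^(deg f - 1)` inside `𝕊_f`. Conversely `xy -
(xy mod f) = h f`, and `h f z ∈ Rf`. -/
theorem mem_rightNucleus_iff (hd : 2 ≤ natDegree f) {z : S f} :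
    z ∈ rightNucleus (S f) ↔ f * z.1 ∈ Submodule.span (SkewPoly σ) {f} := by
  have hf0 : f ≠ 0 := by rintro rfl; simp [natDegree] at hd
  constructor
  · intro hz
    have h1 : 1 < natDegree f := hd
    have h2 : natDegree f - 1 < natDegree f := by omega
    exact mul_mem_span_of_assoc hf0 (S.monomial_val_ne_zero h1) (S.monomial_val_ne_zero h2)
      (by rw [S.natDegree_monomial_val, S.natDegree_monomial_val]; omega) (hz _ _)
  · intro hz x y
    rw [assoc_iff hf0]
    obtain ⟨h, e⟩ := mem_span_singleton_iff.mp (sub_modRight_mem_span hf0 (x.1 * y.1))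
    rw [e, mul_assoc]
    exact Submodule.smul_mem _ h hz

/-- The right nucleus is the eigenring of `f`. -/
theorem card_rightNucleus (hd : 2 ≤ natDegree f) :
    Nat.card (rightNucleus (S f)) = Nat.card
      (Module.End (SkewPoly σ) (SkewPoly σ ⧸ Submodule.span (SkewPoly σ) {f})) := by
  have hf0 : f ≠ 0 := by rintro rfl; simp [natDegree] at hd
  refine Nat.card_congr (Equiv.ofBijective (fun z : rightNucleus (S f) =>
    Submodule.liftQ _ (LinearMap.toSpanSingleton (SkewPoly σ) _ (Submodule.Quotient.mk z.1.1)) ?_)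
    ⟨?_, ?_⟩)
  · rw [Submodule.span_singleton_le_iff_mem, LinearMap.mem_ker, LinearMap.toSpanSingleton_apply,
      ← Submodule.Quotient.mk_smul, Submodule.Quotient.mk_eq_zero]
    exact (mem_rightNucleus_iff hd).mp z.2
  · intro z w h
    have h1 := LinearMap.congr_fun h (Submodule.Quotient.mk 1)
    simp only [Submodule.liftQ_apply, LinearMap.toSpanSingleton_apply, one_smul] at h1
    exact Subtype.ext ((quotEquiv hf0).injective h1)
  · intro e
    obtain ⟨z, hz⟩ := (quotEquiv hf0).surjective (e (Submodule.Quotient.mk 1))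
    have he : ∀ p : SkewPoly σ, e (Submodule.Quotient.mk p) =
        p • (Submodule.Quotient.mk z.1 : SkewPoly σ ⧸ Submodule.span (SkewPoly σ) {f}) := by
      intro p
      rw [← quotEquiv_apply hf0, hz, ← map_smul, ← Submodule.Quotient.mk_smul, smul_eq_mul,
        mul_one]
    refine ⟨⟨z, (mem_rightNucleus_iff hd).mpr ?_⟩, ?_⟩
    -- The class of `f z` is the image under `e` of the class of `f`, which is zero.
    · rw [← Submodule.Quotient.mk_eq_zero, ← smul_eq_mul, Submodule.Quotient.mk_smul, ← he,
        (Submodule.Quotient.mk_eq_zero _).mpr (Submodule.mem_span_singleton_self f), map_zero]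
    · refine LinearMap.ext fun v => ?_
      obtain ⟨p, rfl⟩ := Submodule.Quotient.mk_surjective _ v
      exact (he p).symm

theorem centre_eq (hd : 2 ≤ natDegree f) {n : ℕ}
    (hσ : ∀ i, (∀ a : Twist σ, φ^[i] a = a) ↔ n ∣ i)
    (hf : ∃ z : S f, f * z.1 ∉ Submodule.span (SkewPoly σ) {f}) :
    centre (S f) = S.C (f := f) (by omega) '' {c : Twist σ | φ c = c} := by
  have hd0 : 0 < natDegree f := by omega
  have hf0 : f ≠ 0 := by rintro rfl; simp [natDegree] at hd
  ext x
  constructor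
  · rintro ⟨⟨⟨hl, -⟩, -⟩, hcomm⟩
    rw [leftNucleus_eq hd0 hf] at hl
    obtain ⟨c, rfl⟩ := hl
    refine ⟨c, ?_, rfl⟩
    -- Because `2 ≤ deg f`, the products of `c` and `t` are not reduced, so `c t = t c` holds in `R`
    -- and gives `σ c = c`.
    have h := congrArg Subtype.val (hcomm (S.monomial (k := 1) hd))
    have hX : (SkewPolynomial.X : SkewPoly σ) ∈ degreeLT σ (natDegree f) :=
      monomial_mem_degreeLT 1 hd
    rw [S.mul_val, S.mul_val, S.C_val, S.monomial_val, monomial_one_one_eq_X,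
      modRight_of_mem hf0 (C_mul_mem_degreeLT hX c),
      modRight_of_mem hf0 (mul_C_mem_degreeLT hX c)] at h
    have h1 := phi_coeff_eq_of_X_mul h.symm 0
    rwa [coeff_C_zero] at h1
  · rintro ⟨c, hc, rfl⟩
    have hcomm : ∀ p : SkewPoly σ, C c * p = p * C c := by
      apply mul_comm_of_coeff fun i => (hσ i).mpr
      · intro i
        rw [coeff_C]
        split_ifs
        · exact hc
        · exact map_zero _
      · intro i hi
        have : i = 0 := by
          by_contra hne
          exact hi (coeff_C_ne_zero hne)
        rw [this]
        exact dvd_zero n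
    refine ⟨⟨⟨?_, ?_⟩, ?_⟩, fun y => Subtype.ext ?_⟩
    · rw [leftNucleus_eq hd0 hf]; exact ⟨c, rfl⟩
    · rw [middleNucleus_eq hd0 hf]; exact ⟨c, rfl⟩
    · rw [mem_rightNucleus_iff hd, S.C_val, ← hcomm]
      exact mem_span_singleton_iff.mpr ⟨_, rfl⟩
    · rw [S.mul_val, S.mul_val, S.C_val, hcomm]

end Nuclei

end

end SkewSemifield

/-! ### The four cardinalities. -/

theorem mainTheorem5 {K : Type*} [Field K] [Finite K] (σ : K ≃+* K) (q n d : ℕ)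
    (hq : Nat.card {a : K // σ a = a} = q) (hK : Nat.card K = q ^ n)
    (hn : 2 ≤ n) (hd : 2 ≤ d)
    (f : SkewSemifield.SkewPoly σ) (hf : SkewSemifield.IsIrred f)
    (hfd : SkewSemifield.natDegree f = d) :
    Nat.card (SkewSemifield.centre (SkewSemifield.S f)) = q ∧
    Nat.card (SkewSemifield.leftNucleus (SkewSemifield.S f)) = q ^ n ∧
    Nat.card (SkewSemifield.middleNucleus (SkewSemifield.S f)) = q ^ n ∧
    Nat.card (SkewSemifield.rightNucleus (SkewSemifield.S f)) = q ^ d := by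
  open SkewSemifield in
  subst hfd
  have hd0 : 0 < natDegree f := by omega
  have hf0 : f ≠ 0 := by rintro rfl; simp [natDegree] at hd
  have hσ := forall_iterate_phi_eq_iff hq hK
  have hq1 : 1 < q := by
    have : 1 < Nat.card K := Finite.one_lt_card
    rw [hK] at this
    exact (Nat.one_lt_pow_iff (by omega)).mp this
  have := isSimpleModule_quot hf hd0
  have : Finite (SkewPoly σ ⧸ Submodule.span (SkewPoly σ) {f}) := .of_equiv _ (quotEquiv hf0)
  have hX : ∃ v : SkewPoly σ ⧸ Submodule.span (SkewPoly σ) {f},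
      (SkewPolynomial.X : SkewPoly σ) • v ≠ 0 := by
    -- `t` sends the class of `1` to that of `t`, nonzero since `1 < deg f`.
    refine ⟨Submodule.Quotient.mk 1, fun h => ?_⟩
    rw [← Submodule.Quotient.mk_smul, Submodule.Quotient.mk_eq_zero, smul_eq_mul, mul_one] at h
    exact SkewPolynomial.X_ne_zero (eq_zero_of_mem_span (monomial_mem_degreeLT 1 hd) h)
  obtain ⟨s, hE, hV⟩ := exists_card_simple_eq (by omega) hσ hq hK hX
  rw [card_quot hf0, hK, ← pow_mul] at hV
  have hs : natDegree f = s :=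
    Nat.eq_of_mul_eq_mul_left (by omega) (Nat.pow_right_injective hq1 hV)
  have hr : Nat.card (rightNucleus (S f)) = q ^ natDegree f := by
    rw [card_rightNucleus hd, hE, hs]
  have hne : ∃ z : S f, f * z.1 ∉ Submodule.span (SkewPoly σ) {f} := by
    -- Otherwise the right nucleus would be all of `𝕊_f`, so `q^(nd) = q^d`, impossible for `n ≥ 2`.
    by_contra! h
    have hall : rightNucleus (S f) = Set.univ :=
      Set.eq_univ_of_forall fun z => (mem_rightNucleus_iff hd).mpr (h z)
    have hS : Nat.card (S f) = Nat.card K ^ natDegree f := card_degreeLT (σ := σ) _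
    rw [hall, Nat.card_univ, hS, hK, ← pow_mul] at hr
    have h1 := Nat.pow_right_injective hq1 hr
    nlinarith
  have hCcard : Nat.card (Set.range (S.C (f := f) hd0)) = q ^ n := by
    rw [Nat.card_range_of_injective (S.C_injective hd0), ← hK]
    rfl
  refine ⟨?_, ?_, ?_, hr⟩
  · rw [centre_eq hd hσ hne, Nat.card_image_of_injective (S.C_injective hd0), ← hq]
    rfl
  · rw [leftNucleus_eq hd0 hne, hCcard]
  · rw [middleNucleus_eq hd0 hne, hCcard]
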